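/- Let $f,g:(0,\infty)\to\mathbb{R}$ be convex functions with $f(1)=g(1)=0$. For such an $f$ put $f(0)=\lim_{t\downarrow 0}f(t)\in(-\infty,\infty]$ and $f^*(0)=\lim_{t\downarrow 0}t f(1/t)\in(-\infty,\infty]$. For probability measures $P,Q$ on a measurable space, with densities $p,q$ with respect to a dominating $\sigma$-finite measure, let $$D_f(P,Q)=\int_{\{q>0\}}f\!\left(\frac pq\right)dQ+f^*(0)\,P(q=0)\in[0,\infty]$$ (with $\infty\cdot 0=0$; the value does not depend on the dominating measure), and define $D_g$ in the same way. A point $(x,y)\in\mathbb{R}^2$ is called $(f,g)$-achievable if $(x,y)=(D_f(P,Q),D_g(P,Q))$ for some probability measures $P,Q$ on some measurable space (so both divergences are finite), and $d$-achievable if this holds for some probability vectors $P,Q\in\mathbb{R}^d$, regarded as probability measures on a set of $d$ elements. Theorem. Every $(f,g)$-achievable point is a convex combination of two $2$-achievable points. Consequently, every $(f,g)$-achievable point is $4$-achievable, and the set of $(f,g)$-achievable points is the convex hull of the set of $2$-achievable points. -/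

import Mathlib

open MeasureTheory Filter Topology

universe u

noncomputable section

namespace JointRange

/-- The extension of `f : (0,∞) → ℝ` to `[0,∞)` with values in the extended reals:
`f` itself on `(0,∞)`, and `lim_{t → 0+} f t` at `0`. Only the values of `f` on `(0,∞)` are
used. The limit exists in `(-∞, ∞]` when `f` is convex on `(0,∞)`. -/
def extendZero (f : ℝ → ℝ) (t : ℝ) : EReal :=
  if 0 < t then (f t : EReal) else limUnder (𝓝[>] (0 : ℝ)) (fun s : ℝ => (f s : EReal))

/-- The adjoint function `f* (t) = t f (1/t)`, for `t > 0`; the value `f* (0)` is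
`extendZero (fStar f) 0`. -/
def fStar (f : ℝ → ℝ) (t : ℝ) : ℝ := t * f t⁻¹

/-- Lebesgue integral of an extended-real function: the integral of the positive part minus the
integral of the negative part. It is meaningful as soon as one of the two is finite. -/
def eintegral {Ω : Type*} [MeasurableSpace Ω] (μ : Measure Ω) (h : Ω → EReal) : EReal :=
  ((∫⁻ x, (h x).toENNReal ∂μ : ENNReal) : EReal)
    - ((∫⁻ x, (-h x).toENNReal ∂μ : ENNReal) : EReal)

/-- With `p = dP/dμ` and `q = dQ/dμ`, the quantity
`∫_{q > 0} f (p/q) dQ + f* (0) P (q = 0)`. For `f` convex on `(0,∞)` the negative part in the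
integral is integrable, since `f` has an affine minorant, so that the value is in `(-∞, ∞]`. -/
def fDivWrt {Ω : Type*} [MeasurableSpace Ω] (μ : Measure Ω) (f : ℝ → ℝ) (P Q : Measure Ω) :
    EReal :=
  eintegral (Q.restrict {x | 0 < Q.rnDeriv μ x})
      (fun x => extendZero f (P.rnDeriv μ x / Q.rnDeriv μ x).toReal)
    + extendZero (fStar f) 0 * ((P {x | Q.rnDeriv μ x = 0} : ENNReal) : EReal)

/-- The `f`-divergence `D_f (P, Q)`, computed with the dominating measure `P + Q`. By
`fDivWrt_eq_fDiv` every other σ-finite dominating measure gives the same value. -/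
def fDiv {Ω : Type*} [MeasurableSpace Ω] (f : ℝ → ℝ) (P Q : Measure Ω) : EReal :=
  fDivWrt (P + Q) f P Q

theorem eintegral_congr {Ω : Type*} [MeasurableSpace Ω] {μ : Measure Ω} {h k : Ω → EReal}
    (hk : h =ᵐ[μ] k) : eintegral μ h = eintegral μ k := by
  unfold eintegral
  congr 2
  · exact lintegral_congr_ae (hk.mono fun x hx => by simp only [hx])
  · exact lintegral_congr_ae (hk.mono fun x hx => by simp only [hx])

/-- The `f`-divergence does not depend on the dominating measure. -/
theorem fDivWrt_eq_fDiv {Ω : Type*} [MeasurableSpace Ω] (μ : Measure Ω) [SigmaFinite μ]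
    (f : ℝ → ℝ) (P Q : Measure Ω) [IsFiniteMeasure P] [IsFiniteMeasure Q]
    (hP : P ≪ μ) (hQ : Q ≪ μ) : fDivWrt μ f P Q = fDiv f P Q := by
  have hPν : P ≪ P + Q := Measure.AbsolutelyContinuous.rfl.add_right Q
  have hQν : Q ≪ P + Q := by
    rw [add_comm]; exact Measure.AbsolutelyContinuous.rfl.add_right P
  have hν : P + Q ≪ μ := Measure.AbsolutelyContinuous.add_left hP hQ
  have e1 := hν.ae_le (Measure.rnDeriv_mul_rnDeriv (κ := μ) hPν)
  have e2 := hν.ae_le (Measure.rnDeriv_mul_rnDeriv (κ := μ) hQν)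
  have e3 := Measure.rnDeriv_pos hν
  have e4 := hν.ae_le (Measure.rnDeriv_lt_top (P + Q) μ)
  have key : ∀ᵐ x ∂(P + Q),
      P.rnDeriv μ x / Q.rnDeriv μ x = P.rnDeriv (P + Q) x / Q.rnDeriv (P + Q) x ∧
      (Q.rnDeriv μ x = 0 ↔ Q.rnDeriv (P + Q) x = 0) := by
    filter_upwards [e1, e2, e3, e4] with x h1 h2 h3 h4
    rw [← h1, ← h2]
    simp only [Pi.mul_apply]
    refine ⟨ENNReal.mul_div_mul_right _ _ h3.ne' h4.ne, ?_⟩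
    simp [h3.ne']
  have kP := Filter.Eventually.filter_mono hPν.ae_le key
  have kQ := Filter.Eventually.filter_mono hQν.ae_le key
  have hset : ({x | 0 < Q.rnDeriv μ x} : Set Ω) =ᵐ[Q] {x | 0 < Q.rnDeriv (P + Q) x} := by
    refine Filter.eventuallyEq_set.2 (kQ.mono fun x hx => ?_)
    simp only [Set.mem_ofPred_eq, pos_iff_ne_zero, ne_eq, hx.2]
  have hset0 : ({x | Q.rnDeriv μ x = 0} : Set Ω) =ᵐ[P] {x | Q.rnDeriv (P + Q) x = 0} :=
    Filter.eventuallyEq_set.2 (kP.mono fun x hx => hx.2)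
  unfold fDiv fDivWrt
  rw [Measure.restrict_congr_set hset, measure_congr hset0]
  congr 1
  refine eintegral_congr (ae_restrict_of_ae (kQ.mono fun x hx => ?_))
  simp only [hx.1]

/-- The point `z` of the plane is `(f, g)`-achievable: `z = (D_f (P, Q), D_g (P, Q))` for some
probability measures `P`, `Q` on some measurable space. Both divergences are finite. -/
def Achievable (f g : ℝ → ℝ) (z : ℝ × ℝ) : Prop :=
  ∃ (Ω : Type u) (_ : MeasurableSpace Ω) (P Q : Measure Ω),
    IsProbabilityMeasure P ∧ IsProbabilityMeasure Q ∧
      fDiv f P Q = (z.1 : EReal) ∧ fDiv g P Q = (z.2 : EReal)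

/-- The measure on `{0, …, d-1}` with point masses `v 0, …, v (d-1)`. -/
def vecMeasure {d : ℕ} (v : Fin d → ℝ) : Measure (Fin d) :=
  ∑ i, ENNReal.ofReal (v i) • Measure.dirac i

/-- The point `z` is `d`-achievable: `z = (D_f (P, Q), D_g (P, Q))` for some probability vectors
`P`, `Q` with `d` entries. -/
def DAchievable (f g : ℝ → ℝ) (d : ℕ) (z : ℝ × ℝ) : Prop :=
  ∃ p q : Fin d → ℝ, p ∈ stdSimplex ℝ (Fin d) ∧ q ∈ stdSimplex ℝ (Fin d) ∧
    fDiv f (vecMeasure p) (vecMeasure q) = (z.1 : EReal) ∧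
    fDiv g (vecMeasure p) (vecMeasure q) = (z.2 : EReal)

end JointRange

end

/-! Let r = dP/d(P+Q), with values in [0,1], and let φ_f(r) = (1-r) f(r/(1-r)) be the perspective of
f, extended by its limits. Then D_f(P,Q) = ∫ φ_f(r) d(P+Q) (`fDiv_eq_coe_iff`). Under the
probability measure ν = (P+Q)/2 the variable r has mean 1/2, and the pair of divergences is the
ν-mean of the curve 2(φ_f, φ_g) at r. Conversely, a finite law of mean 1/2 on parameters where the
curve is finite comes from two probability vectors (`exists_fDiv_eq_iff_isMixture`). The problem
thus concerns means of a curve under laws with prescribed mean.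

A mean lies in the convex hull of the graph of the curve, closed or not
(`Convex.integral_mem_of_finiteDimensional`), so finite laws suffice. A finite law of mean 1/2 is a
mixture of laws of mean 1/2 on at most two points (`Convex.sum_mem_of_sum_mul_eq_zero`), so every
achievable point is in the hull of the 2-achievable ones.

Carathéodory's theorem would need three of these. Two suffice because the 2-achievable set is
connected: all parameters can be contracted to 1/2 (`isPreconnected_isMixture`). In the plane, the
hull of a connected set is a union of segments
(`IsPreconnected.exists_mem_segment_of_mem_convexHull`). Juxtaposing two 2-point laws gives a
4-point law. -/

/-! ### Convex geometry: separation, means, planar hulls, two-point decompositions -/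

/-- A nonzero functional weakly separates a point from a convex set not containing it. -/
theorem Convex.exists_ne_zero_forall_le {E : Type*} [NormedAddCommGroup E] [NormedSpace ℝ E]
    [FiniteDimensional ℝ E] {s : Set E} (hs : Convex ℝ s) (hne : s.Nonempty) {x : E}
    (hx : x ∉ s) : ∃ l : E →L[ℝ] ℝ, l ≠ 0 ∧ ∀ y ∈ s, l y ≤ l x := by
  by_cases hi : (interior s).Nonempty
  · obtain ⟨l, hl⟩ := geometric_hahn_banach_open_point hs.interior isOpen_interior
      (fun h => hx (interior_subset h))
    refine ⟨l, ?_, fun y hy => ?_⟩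
    · rintro rfl
      obtain ⟨a, ha⟩ := hi
      simpa using hl a ha
    · have hy' : y ∈ closure (interior s) := by
        rw [hs.closure_interior_eq_closure_of_nonempty_interior hi]
        exact subset_closure hy
      exact closure_minimal (fun a ha => (hl a ha).le)
        (isClosed_le l.continuous continuous_const) hy'
  -- With empty interior the affine span is proper, so a nonzero functional is constant on `s`; it
  -- or its negative separates.
  · rw [hs.interior_nonempty_iff_affineSpan_eq_top] at hi
    obtain ⟨y₀, hy₀⟩ := hne
    have hd : (affineSpan ℝ s).direction < ⊤ := by
      rw [lt_top_iff_ne_top, Ne, AffineSubspace.direction_eq_top_iff_of_nonempty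
        ⟨y₀, subset_affineSpan ℝ s hy₀⟩]
      exact hi
    obtain ⟨m, hm, hle⟩ := Submodule.exists_le_ker_of_lt_top _ hd
    have hc : ∀ y ∈ s, m y = m y₀ := fun y hy => by
      have := hle (AffineSubspace.vsub_mem_direction (subset_affineSpan ℝ s hy)
        (subset_affineSpan ℝ s hy₀))
      rw [LinearMap.mem_ker, vsub_eq_sub, map_sub] at this
      linarith
    have hm' : m.toContinuousLinearMap ≠ 0 := by simpa using hm
    rcases le_total (m y₀) (m x) with h | h
    · exact ⟨m.toContinuousLinearMap, hm', fun y hy => by simpa [hc y hy] using h⟩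
    · exact ⟨-m.toContinuousLinearMap, neg_ne_zero.2 hm', fun y hy => by
        simpa [hc y hy] using h⟩

/-- In finite dimension, the mean of an integrable random vector with values in a convex set
(closed or not) lies in that set. -/
theorem Convex.integral_mem_of_finiteDimensional {Ω : Type*} [MeasurableSpace Ω] {μ : Measure Ω}
    [IsProbabilityMeasure μ] {E : Type*} [NormedAddCommGroup E] [NormedSpace ℝ E]
    [FiniteDimensional ℝ E] {s : Set E} (hs : Convex ℝ s) {X : Ω → E}
    (hX : ∀ᵐ x ∂μ, X x ∈ s) (hi : Integrable X μ) : ∫ x, X x ∂μ ∈ s := by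
  induction hn : Module.finrank ℝ E using Nat.strong_induction_on generalizing E with
  | _ n ih =>
  by_contra hz
  set z := ∫ x, X x ∂μ with hzdef
  -- The nonnegative variable `l z - l (X x)` has mean zero, so `X` lies almost surely in the
  -- hyperplane `z + ker l`, where the induction on dimension applies.
  obtain ⟨l, hl0, hl⟩ := hs.exists_ne_zero_forall_le (hX.exists.imp' _ fun _ h => h) hz
  have hint : ∫ x, (l z - l (X x)) ∂μ = 0 := by
    rw [integral_sub (integrable_const _) (l.integrable_comp hi), l.integral_comp_comm hi]
    simp [hzdef]
  have hae : ∀ᵐ x ∂μ, l (X x) = l z := by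
    have h0 : 0 ≤ᵐ[μ] fun x => l z - l (X x) := hX.mono fun x hx => sub_nonneg.2 (hl _ hx)
    have := (integral_eq_zero_iff_of_nonneg_ae h0
      ((integrable_const _).sub (l.integrable_comp hi))).1 hint
    exact this.mono fun x hx => by
      have : l z - l (X x) = 0 := hx
      linarith
  let K : Submodule ℝ E := LinearMap.ker (l : E →ₗ[ℝ] ℝ)
  have hK : Module.finrank ℝ K < n := by
    rw [← hn]
    refine Submodule.finrank_lt ?_
    rw [Ne, LinearMap.ker_eq_top]
    intro h
    exact hl0 (ContinuousLinearMap.coe_injective (by simpa using h))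
  -- A retraction onto `K` turns `X - z` into a `K`-valued vector, unchanged almost everywhere and
  -- of mean zero.
  obtain ⟨p, hp⟩ := K.subtype.exists_leftInverse_of_injective K.ker_subtype
  let π : E →L[ℝ] K := p.toContinuousLinearMap
  have hπ : ∀ k : K, π k = k := fun k => LinearMap.congr_fun hp k
  have hsub : Convex ℝ {k : K | z + k ∈ s} := by
    intro a ha b hb α β hα hβ hαβ
    have := hs ha hb hα hβ hαβ
    have e : α • (z + (a : E)) + β • (z + (b : E)) = z + (α • a + β • b : K) := by
      push_cast
      rw [smul_add, smul_add, add_add_add_comm, ← add_smul, hαβ, one_smul]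
    rwa [e] at this
  have key := ih _ hK hsub (X := fun x => π (X x - z)) ?_ ?_ rfl
  · rw [π.integral_comp_comm (φ := fun x => X x - z) (hi.sub (integrable_const _)),
      integral_sub hi (integrable_const _)] at key
    simp only [integral_const, probReal_univ, one_smul, ← hzdef, sub_self, map_zero] at key
    exact hz (by simpa using key)
  · filter_upwards [hX, hae] with x hx hlx
    have hm : X x - z ∈ K := by simp [K, hlx]
    have : π (X x - z) = ⟨X x - z, hm⟩ := hπ ⟨X x - z, hm⟩
    simp [this, hx]
  · exact π.integrable_comp (hi.sub (integrable_const _))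

/-- In the plane, if a preconnected set contains the vertices of a nondegenerate triangle with
`z` in its interior, then `z` lies on a segment with endpoints in the set. -/
theorem IsPreconnected.exists_mem_segment_of_triangle {S : Set (ℝ × ℝ)}
    (hS : IsPreconnected S) {z a b c : ℝ × ℝ} {α β γ : ℝ} (ha : a ∈ S) (hb : b ∈ S) (hc : c ∈ S)
    (hα : 0 < α) (hβ : 0 < β) (hγ : 0 < γ) (h1 : α + β + γ = 1)
    (hz : α • a + β • b + γ • c = z)
    (hdet : (a.1 - z.1) * (b.2 - z.2) - (a.2 - z.2) * (b.1 - z.1) ≠ 0) :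
    ∃ a ∈ S, ∃ b ∈ S, z ∈ segment ℝ a b := by
  by_contra! hcon
  set Δ := (a.1 - z.1) * (b.2 - z.2) - (a.2 - z.2) * (b.1 - z.1) with hΔ
  -- Cramer's rule: `s x` and `t x` are the coordinates of `x - z` in the basis `a - z`, `b - z`.
  let s : ℝ × ℝ → ℝ := fun x => ((x.1 - z.1) * (b.2 - z.2) - (x.2 - z.2) * (b.1 - z.1)) / Δ
  let t : ℝ × ℝ → ℝ := fun x => ((a.1 - z.1) * (x.2 - z.2) - (a.2 - z.2) * (x.1 - z.1)) / Δ
  have hs : Continuous s := by fun_prop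
  have ht : Continuous t := by fun_prop
  have dec : ∀ x, x = z + s x • (a - z) + t x • (b - z) := fun x => by
    ext <;> simp only [s, t, Prod.fst_add, Prod.snd_add, Prod.smul_fst, Prod.smul_snd,
      Prod.fst_sub, Prod.snd_sub, smul_eq_mul] <;> field_simp <;> rw [hΔ] <;> ring
  have opp : ∀ x ∈ S, ∀ y ∈ S, ∀ k : ℝ, k ≤ 0 → x = z + k • (y - z) → False := by
    intro x hx y hy k hk h
    refine hcon x hx y hy ⟨1 / (1 - k), -k / (1 - k), ?_, ?_, ?_, ?_⟩
    · exact div_nonneg zero_le_one (by linarith)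
    · exact div_nonneg (by linarith) (by linarith)
    · rw [← add_div]; exact div_self (by linarith)
    · have : (1 - k) ≠ 0 := by linarith
      rw [h]
      ext <;> simp <;> field_simp <;> ring
  have z1 := congrArg Prod.fst hz
  have z2 := congrArg Prod.snd hz
  simp only [Prod.fst_add, Prod.snd_add, Prod.smul_fst, Prod.smul_snd, smul_eq_mul] at z1 z2
  have hα' : α = 1 - β - γ := by linarith
  have sc : s c = -α / γ := by
    simp only [s]
    rw [div_eq_div_iff hdet hγ.ne', hΔ, ← z1, ← z2, hα']
    ring
  have tc : t c = -β / γ := by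
    simp only [t]
    rw [div_eq_div_iff hdet hγ.ne', hΔ, ← z1, ← z2, hα']
    ring
  -- These disjoint open sets contain `c` and `a`. A point of `S` outside both would lie on the
  -- closed ray from `z` opposite to `a` or to `b`, which `opp` excludes; so they would disconnect
  -- `S`.
  have hU : IsOpen {x | s x < 0 ∧ t x < 0} :=
    (isOpen_lt hs continuous_const).inter (isOpen_lt ht continuous_const)
  have hV : IsOpen {x | 0 < s x ∨ 0 < t x} :=
    (isOpen_lt continuous_const hs).union (isOpen_lt continuous_const ht)
  have hcover : S ⊆ {x | s x < 0 ∧ t x < 0} ∪ {x | 0 < s x ∨ 0 < t x} := by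
    intro x hx
    by_contra h
    simp only [Set.mem_union, Set.mem_ofPred_eq, not_or, not_and, not_lt] at h
    obtain ⟨h1, h2, h3⟩ := h
    rcases h2.lt_or_eq with h2 | h2
    · have h4 : t x = 0 := le_antisymm h3 (h1 h2)
      exact opp x hx a ha (s x) h2.le (by simpa [h4] using dec x)
    · exact opp x hx b hb (t x) h3 (by simpa [h2] using dec x)
  have hcU : s c < 0 ∧ t c < 0 :=
    ⟨sc ▸ div_neg_of_neg_of_pos (by linarith) hγ, tc ▸ div_neg_of_neg_of_pos (by linarith) hγ⟩
  have haV : 0 < s a := by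
    simp only [s]
    rw [← hΔ, div_self hdet]
    exact one_pos
  obtain ⟨x, -, ⟨hx1, hx2⟩, hx3⟩ := hS _ _ hU hV hcover ⟨c, hc, hcU⟩ ⟨a, ha, Or.inl haV⟩
  rcases hx3 with h | h
  · exact h.not_gt hx1
  · exact h.not_gt hx2

/-- In the plane, the convex hull of a preconnected set is a union of segments with endpoints in
the set. -/
theorem IsPreconnected.exists_mem_segment_of_mem_convexHull {S : Set (ℝ × ℝ)}
    (hS : IsPreconnected S) {z : ℝ × ℝ} (hz : z ∈ convexHull ℝ S) :
    ∃ a ∈ S, ∃ b ∈ S, z ∈ segment ℝ a b := by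
  obtain ⟨ι, _, v, w, hv, hind, hw, hw1, hwz⟩ := eq_pos_convex_span_of_mem_convexHull hz
  have hcard : Fintype.card ι ≤ 3 := by
    have := hind.card_le_finrank_succ
    have h2 := Submodule.finrank_le (vectorSpan ℝ (Set.range v))
    have h3 : Module.finrank ℝ (ℝ × ℝ) = 2 := by simp
    omega
  obtain ⟨n, hn⟩ : ∃ n, Fintype.card ι = n := ⟨_, rfl⟩
  let e : Fin n ≃ ι := (Fintype.equivFinOfCardEq hn).symm
  have hmem : ∀ i, v (e i) ∈ S := fun i => hv ⟨_, rfl⟩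
  rw [← e.sum_comp] at hw1 hwz
  rw [hn] at hcard
  interval_cases n
  · simp at hw1
  · simp only [Fin.sum_univ_one] at hw1 hwz
    refine ⟨_, hmem 0, _, hmem 0, ?_⟩
    rw [← hwz, hw1, one_smul]
    exact left_mem_segment _ _ _
  · simp only [Fin.sum_univ_two] at hw1 hwz
    exact ⟨_, hmem 0, _, hmem 1, _, _, (hw _).le, (hw _).le, hw1, hwz⟩
  · simp only [Fin.sum_univ_three] at hw1 hwz
    by_cases hdet : ((v (e 0)).1 - z.1) * ((v (e 1)).2 - z.2)
        - ((v (e 0)).2 - z.2) * ((v (e 1)).1 - z.1) = 0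
    · have hind' := (affineIndependent_equiv e).2 hind
      rw [affineIndependent_iff] at hind'
      have key : ∀ p q : ℝ, p • (v (e 0) - z) + q • (v (e 1) - z) = 0 → p = 0 ∧ q = 0 := by
        intro p q h
        -- Expanding `z` in the three vertices gives these coefficients, of sum zero; since `w (e
        -- 2)` is positive, the last one forces `p + q = 0`.
        have := hind' Finset.univ
          ![p - (p + q) * w (e 0), q - (p + q) * w (e 1), -(p + q) * w (e 2)]
          (by simp only [Fin.sum_univ_three, Matrix.cons_val]; linear_combination -(p + q) * hw1)
          (by
            simp only [Fin.sum_univ_three, Matrix.cons_val, Function.comp]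
            rw [← h, ← hwz]
            module)
        have h2 := this 2 (Finset.mem_univ _)
        have h0 := this 0 (Finset.mem_univ _)
        have h1 := this 1 (Finset.mem_univ _)
        simp only [Matrix.cons_val] at h0 h1 h2
        have : p + q = 0 := by
          rcases mul_eq_zero.1 h2 with h | h
          · linarith
          · exact absurd h (hw _).ne'
        rw [this] at h0 h1
        constructor <;> linarith
      -- A zero determinant yields two relations between `v (e 0) - z` and `v (e 1) - z` with their
      -- coordinates as coefficients; by `key` the coordinates of `v (e 0) - z` vanish.
      have k1 := key ((v (e 1)).1 - z.1) (-((v (e 0)).1 - z.1)) (by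
        ext <;> simp <;> linarith)
      have k2 := key ((v (e 1)).2 - z.2) (-((v (e 0)).2 - z.2)) (by
        ext <;> simp <;> linarith)
      have : z = v (e 0) := by ext <;> linarith [k1.2, k2.2]
      exact ⟨_, hmem 0, _, hmem 0, by rw [this]; exact left_mem_segment _ _ _⟩
    · exact hS.exists_mem_segment_of_triangle (hmem 0) (hmem 1) (hmem 2) (hw _) (hw _) (hw _)
        hw1 hwz hdet

/-- A finite convex combination of points `Φ i` with heights `d i` of mean zero lies in every convex
set that contains the points of height zero on the segments between the points `Φ i`. -/
theorem Convex.sum_mem_of_sum_mul_eq_zero {ι V : Type*} [Fintype ι] [AddCommGroup V] [Module ℝ V]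
    {C : Set V} (hC : Convex ℝ C) {w d : ι → ℝ} {Φ : ι → V} (hw : ∀ i, 0 ≤ w i)
    (hw1 : ∑ i, w i = 1) (hd : ∑ i, w i * d i = 0) (h0 : ∀ i, d i = 0 → Φ i ∈ C)
    (h2 : ∀ i j, 0 ≤ d i → d j < 0 →
      (-d j / (d i - d j)) • Φ i + (d i / (d i - d j)) • Φ j ∈ C) :
    ∑ i, w i • Φ i ∈ C := by
  classical
  set p : Finset ι := Finset.univ.filter fun i => 0 ≤ d i with hp
  set n : Finset ι := Finset.univ.filter fun i => ¬ 0 ≤ d i with hn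
  have split : ∀ F : ι → ℝ, ∑ i, F i = ∑ i ∈ p, F i + ∑ i ∈ n, F i := fun F =>
    (Finset.sum_filter_add_sum_filter_not _ _ _).symm
  have hpm : ∀ i ∈ p, 0 ≤ d i := fun i hi => (Finset.mem_filter.1 hi).2
  have hnm : ∀ i ∈ n, d i < 0 := fun i hi => not_le.1 (Finset.mem_filter.1 hi).2
  -- Mean zero makes the total positive height and the total depth equal to the same `A`; if it
  -- vanishes, all weight sits at height zero.
  set A := ∑ i ∈ p, w i * d i with hA
  have hA' : ∑ j ∈ n, w j * (-d j) = A := by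
    have := split fun i => w i * d i
    simp only [mul_neg, Finset.sum_neg_distrib]
    linarith
  have hA0 : 0 ≤ A := Finset.sum_nonneg fun i hi => mul_nonneg (hw i) (hpm i hi)
  rcases hA0.eq_or_lt with hz | hpos
  · have hall : ∀ i, w i ≠ 0 → Φ i ∈ C := by
      intro i hi
      refine h0 i ?_
      by_cases hdi : 0 ≤ d i
      · have := (Finset.sum_eq_zero_iff_of_nonneg
          fun i hi => mul_nonneg (hw i) (hpm i hi)).1 (hA.symm.trans hz.symm) i
          (Finset.mem_filter.2 ⟨Finset.mem_univ _, hdi⟩)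
        exact (mul_eq_zero.1 this).resolve_left hi
      · have := (Finset.sum_eq_zero_iff_of_nonneg
          fun i hi => mul_nonneg (hw i) (neg_nonneg.2 (hnm i hi).le)).1 (hA'.trans hz.symm) i
          (Finset.mem_filter.2 ⟨Finset.mem_univ _, hdi⟩)
        exact neg_eq_zero.1 ((mul_eq_zero.1 this).resolve_left hi)
    have := hC.finsum_mem hw (by rwa [finsum_eq_sum_of_fintype]) hall
    rwa [finsum_eq_sum_of_fintype] at this
  · have hlt : ∀ i ∈ p, ∀ j ∈ n, 0 < d i - d j := fun i hi j hj => by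
      linarith [hpm i hi, hnm j hj]
    have e1 : ∀ i ∈ p, ∑ j ∈ n, (w i * w j * -d j / A) = w i := fun i _ => by
      rw [← Finset.sum_div, div_eq_iff hpos.ne', ← hA', Finset.mul_sum]
      exact Finset.sum_congr rfl fun _ _ => by ring
    have e2 : ∀ j ∈ n, ∑ i ∈ p, (w i * w j * d i / A) = w j := fun j _ => by
      rw [← Finset.sum_div, div_eq_iff hpos.ne', hA, Finset.mul_sum]
      exact Finset.sum_congr rfl fun _ _ => by ring
    -- Each `i` of height at least zero is coupled with each `j` below zero. The zero-height point
    -- splits the coupled mass into `w i * w j * -d j / A` at `i` and `w i * w j * d i / A` at `j`;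
    -- by `e1` and `e2` these sum to the original weights.
    have key := hC.sum_mem (t := p ×ˢ n)
      (w := fun x => w x.1 * w x.2 * (d x.1 - d x.2) / A)
      (z := fun x => (-d x.2 / (d x.1 - d x.2)) • Φ x.1 + (d x.1 / (d x.1 - d x.2)) • Φ x.2)
      (fun x hx => by
        obtain ⟨hi, hj⟩ := Finset.mem_product.1 hx
        exact div_nonneg (mul_nonneg (mul_nonneg (hw _) (hw _)) (hlt _ hi _ hj).le) hA0)
      (by
        rw [← hw1, split, Finset.sum_product, ← Finset.sum_congr rfl e1, ← Finset.sum_congr rfl e2,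
          Finset.sum_comm (s := n), ← Finset.sum_add_distrib]
        refine Finset.sum_congr rfl fun i _ => ?_
        rw [← Finset.sum_add_distrib]
        exact Finset.sum_congr rfl fun j _ => by ring)
      (fun x hx => by
        obtain ⟨hi, hj⟩ := Finset.mem_product.1 hx
        exact h2 _ _ (hpm _ hi) (hnm _ hj))
    convert key using 1
    rw [← Finset.sum_filter_add_sum_filter_not _ (fun i => 0 ≤ d i), Finset.sum_product,
      Finset.sum_congr rfl fun i hi => congrArg (· • Φ i) (e1 i hi).symm,
      Finset.sum_congr (s₁ := n) rfl fun j hj => congrArg (· • Φ j) (e2 j hj).symm]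
    simp only [Finset.sum_smul]
    rw [Finset.sum_comm (s := n), ← Finset.sum_add_distrib]
    refine Finset.sum_congr rfl fun i hi => ?_
    rw [← Finset.sum_add_distrib]
    refine Finset.sum_congr rfl fun j hj => ?_
    have := (hlt i hi j hj).ne'
    rw [smul_add, smul_smul, smul_smul]
    congr 2 <;> field_simp

namespace JointRange

/-! ### Extended-real integrals with finite value -/

/-- An extended real that is a real number. -/
def IsFinite (e : EReal) : Prop := e ≠ ⊤ ∧ e ≠ ⊥

theorem isFinite_coe (a : ℝ) : IsFinite a := ⟨EReal.coe_ne_top a, EReal.coe_ne_bot a⟩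

theorem IsFinite.coe_toReal {e : EReal} (h : IsFinite e) : (e.toReal : EReal) = e :=
  EReal.coe_toReal h.1 h.2

theorem eq_coe_iff {e : EReal} {c : ℝ} : e = c ↔ IsFinite e ∧ e.toReal = c := by
  refine ⟨?_, fun ⟨h, hc⟩ => by rw [← hc, h.coe_toReal]⟩
  rintro rfl
  exact ⟨isFinite_coe c, EReal.toReal_coe c⟩

theorem add_eq_coe_iff {a b : EReal} {c : ℝ} :
    a + b = c ↔ ∃ c₁ c₂ : ℝ, a = c₁ ∧ b = c₂ ∧ c₁ + c₂ = c := by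
  induction a <;> induction b <;> simp
  norm_cast

/-- An infinite term never leaves a real difference, since `⊤ - ⊤ = ⊥` in `EReal`. -/
theorem coe_ennreal_sub_eq_coe_iff {a b : ENNReal} {c : ℝ} :
    (a : EReal) - b = c ↔ a ≠ ⊤ ∧ b ≠ ⊤ ∧ a.toReal - b.toReal = c := by
  rcases eq_or_ne a ⊤ with rfl | ha <;> rcases eq_or_ne b ⊤ with rfl | hb
  · simp
  · lift b to NNReal using hb
    simp
  · lift a to NNReal using ha
    simp
  · rw [← EReal.coe_toReal (x := a) (by simpa) (by simp),
      ← EReal.coe_toReal (x := b) (by simpa) (by simp), EReal.toReal_coe_ennreal,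
      EReal.toReal_coe_ennreal]
    simp only [ne_eq, ha, hb, not_false_eq_true, true_and]
    norm_cast

/-- The extended-real function `h` is finite almost everywhere and integrable, with
integral `c`. -/
def HasIntegral {Ω : Type*} [MeasurableSpace Ω] (h : Ω → EReal) (μ : Measure Ω) (c : ℝ) : Prop :=
  (∀ᵐ x ∂μ, IsFinite (h x)) ∧ Integrable (fun x => (h x).toReal) μ ∧ ∫ x, (h x).toReal ∂μ = c

theorem HasIntegral.congr {Ω : Type*} [MeasurableSpace Ω] {h k : Ω → EReal} {μ : Measure Ω}
    {c : ℝ} (hk : h =ᵐ[μ] k) (hh : HasIntegral h μ c) : HasIntegral k μ c := by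
  have hr : (fun x => (h x).toReal) =ᵐ[μ] fun x => (k x).toReal :=
    hk.mono fun x hx => congrArg EReal.toReal hx
  refine ⟨?_, hh.2.1.congr hr, (integral_congr_ae hr).symm.trans hh.2.2⟩
  filter_upwards [hh.1, hk] with x h1 h2
  rwa [← h2]

theorem hasIntegral_congr {Ω : Type*} [MeasurableSpace Ω] {h k : Ω → EReal} {μ : Measure Ω}
    {c : ℝ} (hk : h =ᵐ[μ] k) : HasIntegral h μ c ↔ HasIntegral k μ c :=
  ⟨fun hh => hh.congr hk, fun hh => hh.congr hk.symm⟩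

theorem hasIntegral_add_measure {Ω : Type*} [MeasurableSpace Ω] {h : Ω → EReal}
    {μ ν : Measure Ω} {c : ℝ} : HasIntegral h (μ + ν) c ↔
      ∃ c₁ c₂ : ℝ, HasIntegral h μ c₁ ∧ HasIntegral h ν c₂ ∧ c₁ + c₂ = c := by
  constructor
  · rintro ⟨h1, h2, h3⟩
    rw [ae_add_measure_iff] at h1
    rw [integrable_add_measure] at h2
    rw [integral_add_measure h2.1 h2.2] at h3
    exact ⟨_, _, ⟨h1.1, h2.1, rfl⟩, ⟨h1.2, h2.2, rfl⟩, h3⟩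
  · rintro ⟨c₁, c₂, ⟨h1, h2, rfl⟩, ⟨h1', h2', rfl⟩, rfl⟩
    exact ⟨ae_add_measure_iff.2 ⟨h1, h1'⟩, integrable_add_measure.2 ⟨h2, h2'⟩,
      integral_add_measure h2 h2'⟩

/-- Finite integrals of the positive and negative parts give finiteness almost everywhere, and their
sum bounds the integral of the absolute value; the Bochner integral is then available. -/
theorem eintegral_eq_coe_iff {Ω : Type*} [MeasurableSpace Ω] {μ : Measure Ω} {h : Ω → EReal}
    (hm : Measurable h) {c : ℝ} : eintegral μ h = c ↔ HasIntegral h μ c := by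
  have hpos : ∀ e : EReal, IsFinite e → e.toENNReal = ENNReal.ofReal e.toReal :=
    fun e he => EReal.toENNReal_of_ne_top he.1
  have hneg : ∀ e : EReal, IsFinite e → (-e).toENNReal = ENNReal.ofReal (-e.toReal) :=
    fun e he => by rw [EReal.toENNReal_of_ne_top (by simpa using he.2), EReal.toReal_neg_eq]
  have hcongr : (∀ᵐ x ∂μ, IsFinite (h x)) →
      ∫⁻ x, (h x).toENNReal ∂μ = ∫⁻ x, ENNReal.ofReal (h x).toReal ∂μ ∧
      ∫⁻ x, (-h x).toENNReal ∂μ = ∫⁻ x, ENNReal.ofReal (-(h x).toReal) ∂μ := fun hf =>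
    ⟨lintegral_congr_ae (hf.mono fun x hx => hpos _ hx),
      lintegral_congr_ae (hf.mono fun x hx => hneg _ hx)⟩
  unfold eintegral HasIntegral
  rw [coe_ennreal_sub_eq_coe_iff]
  constructor
  · rintro ⟨h1, h2, h3⟩
    have hf : ∀ᵐ x ∂μ, IsFinite (h x) := by
      filter_upwards [ae_lt_top hm.ereal_toENNReal h1, ae_lt_top hm.neg.ereal_toENNReal h2]
        with x hx1 hx2
      refine ⟨fun h => ?_, fun h => ?_⟩
      · simp [h] at hx1
      · simp [h] at hx2
    have hi : Integrable (fun x => (h x).toReal) μ := by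
      refine ⟨hm.ereal_toReal.aestronglyMeasurable, ?_⟩
      rw [hasFiniteIntegral_iff_enorm]
      refine lt_of_le_of_lt (lintegral_mono_ae (g := fun x => (h x).toENNReal + (-h x).toENNReal)
        (hf.mono fun x hx => ?_)) (by
          rw [lintegral_add_left hm.ereal_toENNReal]
          exact ENNReal.add_lt_top.2 ⟨h1.lt_top, h2.lt_top⟩)
      rw [hpos _ hx, hneg _ hx, Real.enorm_eq_ofReal_abs]
      rcases abs_cases (h x).toReal with h | h
      · rw [h.1]; exact le_self_add
      · rw [h.1]; exact le_add_self
    refine ⟨hf, hi, ?_⟩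
    rw [integral_eq_lintegral_pos_part_sub_lintegral_neg_part hi, ← (hcongr hf).1,
      ← (hcongr hf).2, h3]
  · rintro ⟨hf, hi, hc⟩
    rw [integral_eq_lintegral_pos_part_sub_lintegral_neg_part hi, ← (hcongr hf).1,
      ← (hcongr hf).2] at hc
    rw [(hcongr hf).1, (hcongr hf).2] at *
    refine ⟨hi.lintegral_lt_top.ne, hi.neg.lintegral_lt_top.ne, hc⟩

/-! ### Divergences as integrals of perspectives -/

/-- The perspective `r ↦ (1 - r) f (r / (1 - r))` of `f` on `[0,1]`, with its limits at `0`
and `1`. -/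
noncomputable def perspective (f : ℝ → ℝ) (r : ℝ) : EReal :=
  if r < 1 then ((1 - r : ℝ) : EReal) * extendZero f (r / (1 - r)) else extendZero (fStar f) 0

theorem isFinite_coe_mul_iff {a : ℝ} (ha : 0 < a) {e : EReal} :
    IsFinite ((a : EReal) * e) ↔ IsFinite e := by
  induction e <;> simp [IsFinite, EReal.coe_mul_top_of_pos ha, EReal.coe_mul_bot_of_pos ha]
  norm_cast
  exact isFinite_coe _

theorem measurable_extendZero {f : ℝ → ℝ} (hf : ConvexOn ℝ (Set.Ioi 0) f) :
    Measurable (extendZero f) := by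
  classical
  have h := (ContinuousOn.measurable_piecewise
    (continuous_coe_real_ereal.comp_continuousOn (hf.continuousOn isOpen_Ioi))
    (continuousOn_const (c := limUnder (𝓝[>] (0 : ℝ)) (fun s : ℝ => (f s : EReal))))
    measurableSet_Ioi)
  convert h using 1
  ext t
  simp [extendZero, Set.piecewise]

/-- Lets the singular term of the divergence be read as an integral over `{q = 0}`. For `μ = 0` both
sides say `c = 0`, even for infinite `e`, as `e * 0 = 0`. -/
theorem hasIntegral_const_iff {Ω : Type*} [MeasurableSpace Ω] {μ : Measure Ω} [IsFiniteMeasure μ]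
    {e : EReal} {c : ℝ} :
    HasIntegral (fun _ => e) μ c ↔ e * ((μ Set.univ : ENNReal) : EReal) = c := by
  rcases eq_or_ne μ 0 with rfl | hμ
  · simp only [HasIntegral, ae_zero, eventually_bot, integrable_zero_measure,
      integral_zero_measure, true_and, Measure.coe_zero, Pi.zero_apply, EReal.coe_ennreal_zero,
      mul_zero]
    norm_cast
  have : NeZero μ := ⟨hμ⟩
  have hpos : 0 < μ.real Set.univ := by
    rw [measureReal_def]
    exact ENNReal.toReal_pos (by simpa using hμ) (measure_ne_top _ _)
  have hcoe : ((μ Set.univ : ENNReal) : EReal) = (μ.real Set.univ : ℝ) := by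
    rw [measureReal_def, ← EReal.toReal_coe_ennreal, EReal.coe_toReal (by simp) (by simp)]
  rw [mul_comm, eq_coe_iff, hcoe, isFinite_coe_mul_iff hpos, EReal.toReal_mul, EReal.toReal_coe]
  simp [HasIntegral]

/-- A finite `f`-divergence is the integral of the perspective of `f` at the density of `P` with
respect to `P + Q`. -/
theorem fDiv_eq_coe_iff {Ω : Type*} [MeasurableSpace Ω] {f : ℝ → ℝ}
    (hf : ConvexOn ℝ (Set.Ioi 0) f) (P Q : Measure Ω) [IsFiniteMeasure P] [IsFiniteMeasure Q]
    {c : ℝ} : fDiv f P Q = c ↔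
      HasIntegral (fun x => perspective f (P.rnDeriv (P + Q) x).toReal) (P + Q) c := by
  unfold fDiv fDivWrt
  have hP : P ≪ P + Q := Measure.AbsolutelyContinuous.rfl.add_right Q
  have hQ : Q ≪ P + Q := by
    rw [add_comm]; exact Measure.AbsolutelyContinuous.rfl.add_right P
  have hsum : ∀ᵐ x ∂(P + Q), P.rnDeriv (P + Q) x + Q.rnDeriv (P + Q) x = 1 := by
    filter_upwards [Measure.rnDeriv_add P Q (P + Q), Measure.rnDeriv_self (P + Q)] with x h1 h2
    rw [← h2, h1, Pi.add_apply]
  have hQμ : Q = (P + Q).withDensity (Q.rnDeriv (P + Q)) :=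
    (Measure.withDensity_rnDeriv_eq Q (P + Q) hQ).symm
  have hpm := Measure.measurable_rnDeriv P (P + Q)
  have hqm := Measure.measurable_rnDeriv Q (P + Q)
  set p := P.rnDeriv (P + Q)
  set q := Q.rnDeriv (P + Q)
  have hS : MeasurableSet {x | 0 < q x} := measurableSet_lt measurable_const hqm
  have hSc : {x | q x = 0} = {x | 0 < q x}ᶜ := by
    ext x; simp [pos_iff_ne_zero]
  have hreal : ∀ᵐ x ∂(P + Q), q x < ⊤ ∧ (q x).toReal = 1 - (p x).toReal := by
    filter_upwards [hsum] with x hx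
    have h1 : p x ≠ ⊤ := fun h => by simp [h] at hx
    have h2 : q x ≠ ⊤ := fun h => by simp [h] at hx
    have := congrArg ENNReal.toReal hx
    rw [ENNReal.toReal_add h1 h2, ENNReal.toReal_one] at this
    exact ⟨h2.lt_top, by linarith⟩
  have hpersp : ∀ᵐ x ∂(P + Q).restrict {x | 0 < q x}, 0 < (q x).toReal ∧
      perspective f (p x).toReal = ((q x).toReal : EReal) * extendZero f (p x / q x).toReal := by
    filter_upwards [ae_restrict_of_ae hreal, ae_restrict_mem hS] with x hx hx0
    have hq : 0 < (q x).toReal := ENNReal.toReal_pos hx0.ne' hx.1.ne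
    refine ⟨hq, ?_⟩
    rw [perspective, if_pos (by linarith [hx.2]), ENNReal.toReal_div, hx.2]
  have hone : ∀ᵐ x ∂(P + Q).restrict {x | q x = 0},
      perspective f (p x).toReal = extendZero (fStar f) 0 := by
    filter_upwards [ae_restrict_of_ae hreal, ae_restrict_mem (hSc ▸ hS.compl)] with x hx hx0
    have : q x = 0 := hx0
    rw [this, ENNReal.toReal_zero] at hx
    rw [perspective, if_neg (by linarith [hx.2])]
  -- `Q` has no mass where its density vanishes, so there `P` and `P + Q` agree.
  have hPS : P {x | q x = 0} = (P + Q) {x | q x = 0} := by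
    have : Q {x | q x = 0} = 0 := by
      rw [hQμ, withDensity_apply _ (hSc ▸ hS.compl), lintegral_eq_zero_iff hqm]
      filter_upwards [ae_restrict_mem (hSc ▸ hS.compl)] with x hx using hx
    simp [this]
  -- On `{q > 0}` one has `dQ = q d(P + Q)` and `q = 1 - p`, so the density supplies the factor `1 -
  -- r` of the perspective.
  have key1 : ∀ c₁ : ℝ, eintegral (Q.restrict {x | 0 < q x})
      (fun x => extendZero f (p x / q x).toReal) = c₁ ↔
      HasIntegral (fun x => perspective f (p x).toReal) ((P + Q).restrict {x | 0 < q x}) c₁ := by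
    intro c₁
    have hlt : ∀ᵐ x ∂(P + Q).restrict {x | 0 < q x}, q x < ⊤ :=
      ae_restrict_of_ae (hreal.mono fun x hx => hx.1)
    have hcongr : (fun x => (q x).toReal • (extendZero f (p x / q x).toReal).toReal)
        =ᵐ[(P + Q).restrict {x | 0 < q x}] fun x => (perspective f (p x).toReal).toReal :=
      hpersp.mono fun x hx => by
        simp only [hx.2, EReal.toReal_mul, EReal.toReal_coe, smul_eq_mul]
    have hQr : Q.restrict {x | 0 < q x} = ((P + Q).restrict {x | 0 < q x}).withDensity q := by
      rw [← restrict_withDensity hS, ← hQμ]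
    have hmeas : Measurable fun x => extendZero f (p x / q x).toReal :=
      (measurable_extendZero hf).comp (hpm.div hqm).ennreal_toReal
    rw [eintegral_eq_coe_iff hmeas, hQr,
      HasIntegral, HasIntegral, ae_withDensity_iff hqm,
      integrable_withDensity_iff_integrable_smul' hqm hlt,
      integral_withDensity_eq_integral_toReal_smul hqm hlt, integrable_congr hcongr,
      integral_congr_ae hcongr]
    refine and_congr_left fun _ => eventually_congr (hpersp.mono fun x hx => ?_)
    rw [hx.2, isFinite_coe_mul_iff hx.1]
    exact ⟨fun h => h (ENNReal.toReal_pos_iff.1 hx.1).1.ne', fun h _ => h⟩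
  have key2 : ∀ c₂ : ℝ, extendZero (fStar f) 0 * ((P {x | q x = 0} : ENNReal) : EReal) = c₂ ↔
      HasIntegral (fun x => perspective f (p x).toReal) ((P + Q).restrict {x | q x = 0}) c₂ := by
    intro c₂
    rw [hasIntegral_congr hone, hasIntegral_const_iff, Measure.restrict_apply_univ, hPS]
  rw [add_eq_coe_iff, ← Measure.restrict_add_restrict_compl (μ := P + Q) hS, ← hSc,
    hasIntegral_add_measure]
  simp only [key1, key2]

/-! ### Limits at the endpoints and continuity of the perspective -/

/-- Slopes inside (0,1) are at most the slope of the chord over [1,2]. Monotonicity then gives a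
limit at 0, and the linear correction vanishes there. -/
theorem antitoneOn_sub_mul_of_convexOn {f : ℝ → ℝ} (hf : ConvexOn ℝ (Set.Ioi 0) f) :
    AntitoneOn (fun t => f t - (f 2 - f 1) * t) (Set.Ioo 0 1) := by
  intro x hx y hy hxy
  rcases hxy.eq_or_lt with rfl | hxy
  · exact le_rfl
  have h1 := hf.slope_mono_adjacent hx.1 (z := 1) (by simp) hxy hy.2
  have h2 := hf.slope_mono_adjacent hy.1 (z := 2) (by simp) hy.2 (by norm_num)
  have h3 := h1.trans h2
  rw [show (2 : ℝ) - 1 = 1 by norm_num, div_one, div_le_iff₀ (by linarith)] at h3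
  simp only
  linarith

/-- A convex function on `(0,∞)` has a limit at `0` in the extended reals. -/
theorem tendsto_extendZero {f : ℝ → ℝ} (hf : ConvexOn ℝ (Set.Ioi 0) f) :
    Tendsto (fun t => (f t : EReal)) (𝓝[>] 0) (𝓝 (extendZero f 0)) := by
  rw [extendZero, if_neg (lt_irrefl _)]
  refine tendsto_nhds_limUnder ?_
  have hanti : AntitoneOn (fun t => ((f t - (f 2 - f 1) * t : ℝ) : EReal)) (Set.Ioo 0 1) :=
    fun x hx y hy hxy => EReal.coe_le_coe_iff.2 (antitoneOn_sub_mul_of_convexOn hf hx hy hxy)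
  have hlim := hanti.tendsto_nhdsWithin_Ioo_right ⟨1 / 2, by norm_num, by norm_num⟩
    (OrderTop.bddAbove _)
  have hlin : Tendsto (fun t : ℝ => (((f 2 - f 1) * t : ℝ) : EReal)) (𝓝[>] 0)
      (𝓝 ((0 : ℝ) : EReal)) := by
    refine (continuous_coe_real_ereal.tendsto 0).comp ?_
    refine Tendsto.mono_left ?_ nhdsWithin_le_nhds
    simpa using (continuous_const_mul (f 2 - f 1)).tendsto 0
  refine ⟨_, ((EReal.continuousAt_add (p := (_, ((0 : ℝ) : EReal))) (Or.inr (EReal.coe_ne_bot 0))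
    (Or.inr (EReal.coe_ne_top 0))).tendsto.comp (hlim.prodMk_nhds hlin)).congr fun t => ?_⟩
  simp only [Function.comp]
  norm_cast
  ring

/-- The inverse of `a * x + b * y` is the convex combination of `x⁻¹` and `y⁻¹` with weights
proportional to `a * x` and `b * y`. -/
theorem convexOn_fStar {f : ℝ → ℝ} (hf : ConvexOn ℝ (Set.Ioi 0) f) :
    ConvexOn ℝ (Set.Ioi 0) (fStar f) := by
  refine ⟨convex_Ioi 0, fun x hx y hy a b ha hb hab => ?_⟩
  have hx' : 0 < x := hx
  have hy' : 0 < y := hy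
  have hm : 0 < a * x + b * y := convex_Ioi (0 : ℝ) hx hy ha hb hab
  have h := hf.2 (Set.mem_Ioi.2 (inv_pos.2 hx')) (Set.mem_Ioi.2 (inv_pos.2 hy'))
    (show 0 ≤ a * x / (a * x + b * y) by positivity)
    (show 0 ≤ b * y / (a * x + b * y) by positivity)
    (by rw [← add_div, div_self hm.ne'])
  have e : (a * x / (a * x + b * y)) • x⁻¹ + (b * y / (a * x + b * y)) • y⁻¹
      = (a * x + b * y)⁻¹ := by
    simp only [smul_eq_mul]
    field_simp
    linarith
  rw [e] at h
  simp only [fStar, smul_eq_mul] at h ⊢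
  calc (a * x + b * y) * f (a * x + b * y)⁻¹ ≤ _ := mul_le_mul_of_nonneg_left h hm.le
    _ = _ := by field_simp

theorem perspective_of_mem_Ioo (f : ℝ → ℝ) {r : ℝ} (hr : r ∈ Set.Ioo (0 : ℝ) 1) :
    perspective f r = ((1 - r : ℝ) : EReal) * (f (r / (1 - r)) : ℝ) := by
  rw [perspective, if_pos hr.2, extendZero, if_pos (div_pos hr.1 (by linarith [hr.2]))]

/-- The reflection `r ↦ 1 - r` exchanges `f` and `fStar f`, so behaviour at 1 reduces to behaviour
at 0. -/
theorem perspective_eq_mul_fStar (f : ℝ → ℝ) {r : ℝ} (hr : r ∈ Set.Ioo (0 : ℝ) 1) :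
    perspective f r = (r : EReal) * (fStar f ((1 - r) / r) : ℝ) := by
  rw [perspective_of_mem_Ioo f hr, fStar, inv_div, ← EReal.coe_mul, ← EReal.coe_mul, ← mul_assoc,
    mul_div_cancel₀ _ hr.1.ne']

theorem tendsto_coe_mul_of_tendsto_one {l : Filter ℝ} {u : ℝ → ℝ} {v : ℝ → EReal} {e : EReal}
    (hu : Tendsto u l (𝓝 1)) (hv : Tendsto v l (𝓝 e)) :
    Tendsto (fun r => (u r : EReal) * v r) l (𝓝 e) := by
  have := (EReal.continuousAt_mul (p := (((1 : ℝ) : EReal), e)) (Or.inl (by simp))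
    (Or.inl (by simp)) (Or.inl (EReal.coe_ne_bot 1)) (Or.inl (EReal.coe_ne_top 1))).tendsto.comp
    (((continuous_coe_real_ereal.tendsto 1).comp hu).prodMk_nhds hv)
  simpa [Function.comp_def] using this

theorem continuousOn_perspective {f : ℝ → ℝ} (hf : ConvexOn ℝ (Set.Ioi 0) f) :
    ContinuousOn (perspective f) (Set.Icc 0 1) := by
  intro r hr
  rcases hr.1.eq_or_lt with rfl | h0
  · refine ContinuousWithinAt.mono (t := Set.Ici 0) ?_ Set.Icc_subset_Ici_self
    rw [← continuousWithinAt_Ioi_iff_Ici]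
    have e : perspective f 0 = extendZero f 0 := by simp [perspective]
    rw [ContinuousWithinAt, e]
    have hdiv : Tendsto (fun s : ℝ => s / (1 - s)) (𝓝[>] 0) (𝓝[>] 0) := by
      refine tendsto_nhdsWithin_iff.2 ⟨?_, ?_⟩
      · have : ContinuousAt (fun s : ℝ => s / (1 - s)) 0 :=
          continuousAt_id.div (by fun_prop) (by norm_num)
        simpa [ContinuousAt] using this.tendsto.mono_left nhdsWithin_le_nhds
      · filter_upwards [Ioo_mem_nhdsGT one_pos] with s hs
        exact div_pos hs.1 (by linarith [hs.2])
    have hone : Tendsto (fun s : ℝ => 1 - s) (𝓝[>] 0) (𝓝 1) := by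
      have : Continuous fun s : ℝ => 1 - s := by fun_prop
      simpa using (this.tendsto 0).mono_left nhdsWithin_le_nhds
    refine (tendsto_coe_mul_of_tendsto_one hone ((tendsto_extendZero hf).comp hdiv)).congr' ?_
    filter_upwards [Ioo_mem_nhdsGT one_pos] with s hs
    exact (perspective_of_mem_Ioo f hs).symm
  rcases hr.2.eq_or_lt with rfl | h1
  · refine ContinuousWithinAt.mono (t := Set.Iic 1) ?_ Set.Icc_subset_Iic_self
    rw [← continuousWithinAt_Iio_iff_Iic]
    have e : perspective f 1 = extendZero (fStar f) 0 := by simp [perspective]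
    rw [ContinuousWithinAt, e]
    have hdiv : Tendsto (fun s : ℝ => (1 - s) / s) (𝓝[<] 1) (𝓝[>] 0) := by
      refine tendsto_nhdsWithin_iff.2 ⟨?_, ?_⟩
      · have : ContinuousAt (fun s : ℝ => (1 - s) / s) 1 :=
          ContinuousAt.div (by fun_prop) continuousAt_id (by norm_num)
        simpa [ContinuousAt] using this.tendsto.mono_left nhdsWithin_le_nhds
      · filter_upwards [Ioo_mem_nhdsLT one_pos] with s hs
        exact div_pos (by linarith [hs.2]) hs.1
    have hone : Tendsto (fun s : ℝ => s) (𝓝[<] 1) (𝓝 1) := nhdsWithin_le_nhds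
    refine (tendsto_coe_mul_of_tendsto_one hone
      ((tendsto_extendZero (convexOn_fStar hf)).comp hdiv)).congr' ?_
    filter_upwards [Ioo_mem_nhdsLT one_pos] with s hs
    exact (perspective_eq_mul_fStar f hs).symm
  · refine ContinuousAt.continuousWithinAt ?_
    have hc : ContinuousAt (fun s : ℝ => (((1 - s) * f (s / (1 - s)) : ℝ) : EReal)) r := by
      refine continuous_coe_real_ereal.continuousAt.comp ?_
      have hfr : ContinuousAt f (r / (1 - r)) :=
        (hf.continuousOn isOpen_Ioi).continuousAt (Ioi_mem_nhds (div_pos h0 (by linarith)))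
      have hd : ContinuousAt (fun s : ℝ => s / (1 - s)) r :=
        continuousAt_id.div (by fun_prop) (by linarith)
      exact ContinuousAt.mul (by fun_prop)
        (ContinuousAt.comp (f := fun s : ℝ => s / (1 - s)) hfr hd)
    refine hc.congr ?_
    filter_upwards [Ioo_mem_nhds h0 h1] with s hs
    rw [perspective_of_mem_Ioo f hs, EReal.coe_mul]

/-! ### The curve of perspective values -/

/-- The points of `[0,1]` at which the perspectives of `f` and `g` are finite. -/
def finiteDomain (f g : ℝ → ℝ) : Set ℝ :=
  {r | r ∈ Set.Icc (0 : ℝ) 1 ∧ IsFinite (perspective f r) ∧ IsFinite (perspective g r)}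

theorem Ioo_subset_finiteDomain (f g : ℝ → ℝ) : Set.Ioo 0 1 ⊆ finiteDomain f g := by
  intro r hr
  refine ⟨Set.Ioo_subset_Icc_self hr, ?_, ?_⟩ <;>
  · rw [perspective_of_mem_Ioo _ hr, ← EReal.coe_mul]
    exact isFinite_coe _

/-- Twice the real perspectives of `f` and `g`. -/
noncomputable def curve (f g : ℝ → ℝ) (r : ℝ) : ℝ × ℝ :=
  (2 * (perspective f r).toReal, 2 * (perspective g r).toReal)

theorem continuousOn_curve {f g : ℝ → ℝ} (hf : ConvexOn ℝ (Set.Ioi 0) f)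
    (hg : ConvexOn ℝ (Set.Ioi 0) g) : ContinuousOn (curve f g) (finiteDomain f g) := by
  have aux : ∀ {k : ℝ → ℝ}, ConvexOn ℝ (Set.Ioi 0) k →
      (∀ r ∈ finiteDomain f g, IsFinite (perspective k r)) →
      ContinuousOn (fun r => 2 * (perspective k r).toReal) (finiteDomain f g) := by
    intro k hk hfin
    refine continuousOn_const.mul (EReal.continuousOn_toReal.comp
      ((continuousOn_perspective hk).mono fun r hr => hr.1) fun r hr => ?_)
    have := hfin r hr
    simp [this.1, this.2]
  exact (aux hf fun r hr => hr.2.1).prodMk (aux hg fun r hr => hr.2.2)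

/-! ### Divergences on finite sets -/

section Discrete

variable {ι : Type*} [Fintype ι] [MeasurableSpace ι]

/-- The measure on a finite type with point masses `v i`. -/
noncomputable def ptMeasure (v : ι → ℝ) : Measure ι :=
  ∑ i, ENNReal.ofReal (v i) • Measure.dirac i

instance (v : ι → ℝ) : IsFiniteMeasure (ptMeasure v) := by
  refine ⟨?_⟩
  simp [ptMeasure, Measure.finsetSum_apply, ENNReal.sum_lt_top]

theorem isProbabilityMeasure_ptMeasure {v : ι → ℝ} (hv : v ∈ stdSimplex ℝ ι) :
    IsProbabilityMeasure (ptMeasure v) := by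
  refine ⟨?_⟩
  simp only [ptMeasure, Measure.finsetSum_apply, Measure.smul_apply, measure_univ, smul_eq_mul,
    mul_one]
  rw [← ENNReal.ofReal_sum_of_nonneg fun i _ => hv.1 i, hv.2, ENNReal.ofReal_one]

variable [MeasurableSingletonClass ι]

theorem ptMeasure_singleton (v : ι → ℝ) (i : ι) : ptMeasure v {i} = ENNReal.ofReal (v i) := by
  classical
  simp [ptMeasure, Measure.finsetSum_apply, Measure.dirac_apply', Set.indicator_apply, eq_comm]

theorem ptMeasure_add {p q : ι → ℝ} (hp : ∀ i, 0 ≤ p i) (hq : ∀ i, 0 ≤ q i) :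
    ptMeasure p + ptMeasure q = ptMeasure (fun i => p i + q i) := by
  refine Measure.ext_of_singleton fun i => ?_
  rw [Measure.add_apply, ptMeasure_singleton, ptMeasure_singleton, ptMeasure_singleton,
    ENNReal.ofReal_add (hp i) (hq i)]

theorem hasIntegral_ptMeasure_iff {v : ι → ℝ} (hv : ∀ i, 0 ≤ v i) {h : ι → EReal} {c : ℝ} :
    HasIntegral h (ptMeasure v) c ↔
      (∀ i, v i ≠ 0 → IsFinite (h i)) ∧ ∑ i, v i * (h i).toReal = c := by
  have h0 : ∀ i, ENNReal.ofReal (v i) ≠ 0 ↔ v i ≠ 0 := fun i => by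
    rw [Ne, ENNReal.ofReal_eq_zero, not_le]
    exact (hv i).lt_iff_ne'
  have hint : Integrable (fun x => (h x).toReal) (ptMeasure v) := Integrable.of_finite
  rw [HasIntegral, ae_iff_of_countable, integral_fintype hint]
  simp only [measureReal_def, ptMeasure_singleton, h0, hint, true_and, smul_eq_mul,
    ENNReal.toReal_ofReal (hv _)]

/-- The density of `P` with respect to `P + Q` at an atom is the ratio of masses; empty atoms are
null, so the value `0 / 0 = 0` there is harmless. -/
theorem fDiv_ptMeasure_eq_coe_iff {f : ℝ → ℝ} (hf : ConvexOn ℝ (Set.Ioi 0) f) {p q : ι → ℝ}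
    (hp : ∀ i, 0 ≤ p i) (hq : ∀ i, 0 ≤ q i) {c : ℝ} :
    fDiv f (ptMeasure p) (ptMeasure q) = c ↔
      (∀ i, p i + q i ≠ 0 → IsFinite (perspective f (p i / (p i + q i)))) ∧
      ∑ i, (p i + q i) * (perspective f (p i / (p i + q i))).toReal = c := by
  have hpq : ∀ i, 0 ≤ p i + q i := fun i => add_nonneg (hp i) (hq i)
  have hdens : ptMeasure p = (ptMeasure (fun i => p i + q i)).withDensity
      (fun i => ENNReal.ofReal (p i / (p i + q i))) := by
    refine Measure.ext_of_singleton fun i => ?_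
    rw [withDensity_apply _ (measurableSet_singleton i), Measure.restrict_singleton,
      lintegral_smul_measure, lintegral_dirac, ptMeasure_singleton, ptMeasure_singleton,
      smul_eq_mul, ← ENNReal.ofReal_mul (hpq i)]
    congr 1
    rcases (hpq i).eq_or_lt with h | h
    · have := hp i
      have := hq i
      rw [← h]
      linarith
    · field_simp
  have hrn : (ptMeasure p).rnDeriv (ptMeasure (fun i => p i + q i))
      =ᵐ[ptMeasure (fun i => p i + q i)] fun i => ENNReal.ofReal (p i / (p i + q i)) := by
    conv_lhs => rw [hdens]
    exact Measure.rnDeriv_withDensity _ (Measurable.of_discrete)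
  rw [fDiv_eq_coe_iff hf, ptMeasure_add hp hq, ← hasIntegral_ptMeasure_iff hpq]
  refine hasIntegral_congr (hrn.mono fun i hi => ?_)
  simp only [hi, ENNReal.toReal_ofReal (div_nonneg (hp i) (hpq i))]

end Discrete

/-! ### Mixtures of mean 1/2 -/

/-- The point `z` is a mixture, indexed by `ι`, of points of the curve with parameters of
mean `1/2`. -/
def IsMixture (ι : Type*) [Fintype ι] (f g : ℝ → ℝ) (z : ℝ × ℝ) : Prop :=
  ∃ w r : ι → ℝ, w ∈ stdSimplex ℝ ι ∧ (∀ i, r i ∈ finiteDomain f g) ∧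
    ∑ i, w i * r i = 1 / 2 ∧ ∑ i, w i • curve f g (r i) = z

/-- The dictionary is `w = (p + q) / 2`, `r = p / (p + q)`, with inverse `p = 2 w r`, `q = 2 w (1 -
r)`. The mean 1/2 expresses that `p` has total mass 1. -/
theorem exists_fDiv_eq_iff_isMixture (ι : Type*) [Fintype ι] [MeasurableSpace ι]
    [MeasurableSingletonClass ι] {f g : ℝ → ℝ} (hf : ConvexOn ℝ (Set.Ioi 0) f)
    (hg : ConvexOn ℝ (Set.Ioi 0) g) {z : ℝ × ℝ} :
    (∃ p q : ι → ℝ, p ∈ stdSimplex ℝ ι ∧ q ∈ stdSimplex ℝ ι ∧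
      fDiv f (ptMeasure p) (ptMeasure q) = (z.1 : EReal) ∧
      fDiv g (ptMeasure p) (ptMeasure q) = (z.2 : EReal)) ↔ IsMixture ι f g z := by
  constructor
  · rintro ⟨p, q, ⟨hp, hp1⟩, ⟨hq, hq1⟩, h1, h2⟩
    rw [fDiv_ptMeasure_eq_coe_iff hf hp hq] at h1
    rw [fDiv_ptMeasure_eq_coe_iff hg hp hq] at h2
    have hr : ∀ i, ∃ r ∈ finiteDomain f g, (p i + q i) * r = p i ∧
        (p i + q i) * (perspective f (p i / (p i + q i))).toReal
          = (p i + q i) * (perspective f r).toReal ∧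
        (p i + q i) * (perspective g (p i / (p i + q i))).toReal
          = (p i + q i) * (perspective g r).toReal := by
      intro i
      have hpi := hp i
      have hqi := hq i
      by_cases h : p i + q i = 0
      -- An empty atom has weight zero; any parameter in the domain will do, and 1/2 always belongs
      -- to it.
      · exact ⟨1 / 2, Ioo_subset_finiteDomain f g (by norm_num), by linarith, by simp [h],
          by simp [h]⟩
      · have hpos : 0 < p i + q i := lt_of_le_of_ne (by linarith) (Ne.symm h)
        exact ⟨p i / (p i + q i), ⟨⟨by positivity, (div_le_one hpos).2 (by linarith)⟩,
          h1.1 i h, h2.1 i h⟩, mul_div_cancel₀ _ h, rfl, rfl⟩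
    choose r hrD hrp hrf hrg using hr
    refine ⟨fun i => (p i + q i) / 2, r, ⟨fun i => ?_, ?_⟩, hrD, ?_, ?_⟩
    · have := hp i
      have := hq i
      positivity
    · rw [← Finset.sum_div, Finset.sum_add_distrib, hp1, hq1]
      norm_num
    · rw [← hp1, Finset.sum_div]
      exact Finset.sum_congr rfl fun i _ => by rw [← hrp i]; ring
    · ext
      · rw [Prod.fst_sum, ← h1.2]
        refine Finset.sum_congr rfl fun i _ => ?_
        rw [hrf i]
        simp only [curve, Prod.smul_fst, smul_eq_mul]
        ring
      · rw [Prod.snd_sum, ← h2.2]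
        refine Finset.sum_congr rfl fun i _ => ?_
        rw [hrg i]
        simp only [curve, Prod.smul_snd, smul_eq_mul]
        ring
  · rintro ⟨w, r, ⟨hw, hw1⟩, hr, hmean, rfl⟩
    have hp : ∀ i, 0 ≤ 2 * w i * r i := fun i =>
      mul_nonneg (mul_nonneg zero_le_two (hw i)) (hr i).1.1
    have hq : ∀ i, 0 ≤ 2 * w i * (1 - r i) := fun i =>
      mul_nonneg (mul_nonneg zero_le_two (hw i)) (sub_nonneg.2 (hr i).1.2)
    have hsum : ∀ i, 2 * w i * r i + 2 * w i * (1 - r i) = 2 * w i := fun i => by ring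
    have hdiv : ∀ i, w i ≠ 0 → 2 * w i * r i / (2 * w i) = r i := fun i hi => by field_simp
    have key : ∀ {k : ℝ → ℝ} (hk : ConvexOn ℝ (Set.Ioi 0) k)
        (hfin : ∀ i, IsFinite (perspective k (r i))),
        fDiv k (ptMeasure fun i => 2 * w i * r i) (ptMeasure fun i => 2 * w i * (1 - r i)) =
          ((∑ i, w i * (2 * (perspective k (r i)).toReal) : ℝ) : EReal) := by
      intro k hk hfin
      rw [fDiv_ptMeasure_eq_coe_iff hk hp hq]
      simp only [hsum]
      refine ⟨fun i hi => ?_, Finset.sum_congr rfl fun i _ => ?_⟩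
      · rw [hdiv i (by simpa using hi)]
        exact hfin i
      · by_cases hi : w i = 0
        · simp [hi]
        · rw [hdiv i hi]
          ring
    refine ⟨_, _, ⟨hp, ?_⟩, ⟨hq, ?_⟩, ?_, ?_⟩
    · simp only [mul_assoc, ← Finset.mul_sum, hmean]
      norm_num
    · simp only [mul_sub, mul_one, Finset.sum_sub_distrib, mul_assoc, ← Finset.mul_sum, hmean, hw1]
      norm_num
    · rw [key hf fun i => (hr i).2.1, Prod.fst_sum]
      rfl
    · rw [key hg fun i => (hr i).2.2, Prod.snd_sum]
      rfl

theorem dAchievable_iff_isMixture {f g : ℝ → ℝ} (hf : ConvexOn ℝ (Set.Ioi 0) f)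
    (hg : ConvexOn ℝ (Set.Ioi 0) g) {d : ℕ} {z : ℝ × ℝ} :
    DAchievable f g d z ↔ IsMixture (Fin d) f g z :=
  -- `vecMeasure` is `ptMeasure` on `Fin d` by definition.
  exists_fDiv_eq_iff_isMixture (Fin d) hf hg

theorem IsMixture.equiv {ι κ : Type*} [Fintype ι] [Fintype κ] (e : κ ≃ ι) {f g : ℝ → ℝ}
    {z : ℝ × ℝ} (h : IsMixture ι f g z) : IsMixture κ f g z := by
  obtain ⟨w, r, hw, hr, hm, hz⟩ := h
  refine ⟨w ∘ e, r ∘ e, ⟨fun i => hw.1 _, ?_⟩, fun i => hr _, ?_, ?_⟩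
  · rw [← hw.2]; exact e.sum_comp w
  · rw [← hm]; exact e.sum_comp fun i => w i * r i
  · rw [← hz]; exact e.sum_comp fun i => w i • curve f g (r i)

theorem IsMixture.segment {ι κ : Type*} [Fintype ι] [Fintype κ] {f g : ℝ → ℝ} {a b z : ℝ × ℝ}
    (ha : IsMixture ι f g a) (hb : IsMixture κ f g b) (hz : z ∈ segment ℝ a b) :
    IsMixture (ι ⊕ κ) f g z := by
  obtain ⟨w, r, hw, hr, hm, rfl⟩ := ha
  obtain ⟨w', r', hw', hr', hm', rfl⟩ := hb
  obtain ⟨α, β, hα, hβ, hαβ, rfl⟩ := hz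
  refine ⟨Sum.elim (fun i => α * w i) (fun i => β * w' i), Sum.elim r r', ⟨?_, ?_⟩, ?_, ?_, ?_⟩
  · rintro (i | i)
    · exact mul_nonneg hα (hw.1 i)
    · exact mul_nonneg hβ (hw'.1 i)
  · simp [← Finset.mul_sum, hw.2, hw'.2, hαβ]
  · rintro (i | i)
    · exact hr i
    · exact hr' i
  · simp only [Fintype.sum_sum_type, Sum.elim_inl, Sum.elim_inr, mul_assoc, ← Finset.mul_sum, hm,
      hm', ← add_mul, hαβ, one_mul]
  · simp only [Fintype.sum_sum_type, Sum.elim_inl, Sum.elim_inr, mul_smul, ← Finset.smul_sum]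

/-- Mixtures are achievable, in every universe. -/
theorem IsMixture.achievable {ι : Type} [Fintype ι] {f g : ℝ → ℝ}
    (hf : ConvexOn ℝ (Set.Ioi 0) f) (hg : ConvexOn ℝ (Set.Ioi 0) g) {z : ℝ × ℝ}
    (h : IsMixture ι f g z) : Achievable.{u} f g z := by
  let : MeasurableSpace (ULift.{u} ι) := ⊤
  have : MeasurableSingletonClass (ULift.{u} ι) := ⟨fun _ => trivial⟩
  obtain ⟨p, q, hp, hq, h1, h2⟩ :=
    (exists_fDiv_eq_iff_isMixture (ULift.{u} ι) hf hg).2 (h.equiv Equiv.ulift)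
  exact ⟨ULift.{u} ι, ⊤, ptMeasure p, ptMeasure q, isProbabilityMeasure_ptMeasure hp,
    isProbabilityMeasure_ptMeasure hq, h1, h2⟩

/-- The mixtures indexed by a fixed finite type form a preconnected set. -/
theorem isPreconnected_isMixture (ι : Type*) [Fintype ι] {f g : ℝ → ℝ}
    (hf : ConvexOn ℝ (Set.Ioi 0) f) (hg : ConvexOn ℝ (Set.Ioi 0) g) :
    IsPreconnected {z | IsMixture ι f g z} := by
  have hhalf : (1 / 2 : ℝ) ∈ Set.Ioo (0 : ℝ) 1 := by norm_num
  refine isPreconnected_of_forall (curve f g (1 / 2)) ?_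
  rintro z ⟨w, r, hw, hr, hm, rfl⟩
  -- Contraction towards 1/2 keeps the mean; for `t < 1` the parameters are interior, hence in the
  -- domain, and at `t = 0` every mixture becomes `curve f g (1 / 2)`.
  have hD : ∀ i, ∀ t ∈ Set.Icc (0 : ℝ) 1, 1 / 2 + t * (r i - 1 / 2) ∈ finiteDomain f g := by
    intro i t ht
    rcases ht.2.eq_or_lt with rfl | h1
    · simpa using hr i
    · refine Ioo_subset_finiteDomain f g ⟨?_, ?_⟩
      · nlinarith [(hr i).1.1, ht.1]
      · nlinarith [(hr i).1.2, ht.1]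
  refine ⟨(fun t => ∑ i, w i • curve f g (1 / 2 + t * (r i - 1 / 2))) '' Set.Icc 0 1,
    ?_, ?_, ?_, ?_⟩
  · rintro _ ⟨t, ht, rfl⟩
    refine ⟨w, _, hw, fun i => hD i t ht, ?_, rfl⟩
    have : ∀ i, w i * (1 / 2 + t * (r i - 1 / 2)) = w i * (1 / 2 - t / 2) + t * (w i * r i) :=
      fun i => by ring
    simp only [this, Finset.sum_add_distrib, ← Finset.sum_mul, ← Finset.mul_sum, hw.2, hm]
    ring
  · exact ⟨0, by simp, by simp [← Finset.sum_smul, hw.2]⟩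
  · exact ⟨1, by simp, by simp⟩
  · refine isPreconnected_Icc.image _ (continuousOn_finsetSum _ fun i _ => ?_)
    exact ((continuousOn_curve hf hg).comp (by fun_prop) (hD i)).const_smul (w i)

/-- A mixture is a convex combination of mixtures of two points. -/
theorem IsMixture.mem_convexHull {ι : Type*} [Fintype ι] {f g : ℝ → ℝ} {z : ℝ × ℝ}
    (h : IsMixture ι f g z) : z ∈ convexHull ℝ {z | IsMixture (Fin 2) f g z} := by
  obtain ⟨w, r, hw, hr, hm, rfl⟩ := h
  -- With height `r i - 1 / 2`, a zero-height point of a segment is a two-point mixture of mean 1/2.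
  refine (convex_convexHull ℝ _).sum_mem_of_sum_mul_eq_zero (d := fun i => r i - 1 / 2) hw.1 hw.2
    ?_ (fun i hi => subset_convexHull ℝ _ ?_) (fun i j hi hj => subset_convexHull ℝ _ ?_)
  · simp only [mul_sub, Finset.sum_sub_distrib, hm, ← Finset.sum_mul, hw.2]
    norm_num
  · have hri : r i = 1 / 2 := by linarith
    refine ⟨fun _ => 1 / 2, fun _ => r i, ⟨fun _ => by norm_num, by simp⟩, fun _ => hr i, ?_, ?_⟩
    · simp [hri]
    · rw [Fin.sum_univ_two, ← add_smul]
      norm_num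
  · have hpos : 0 < r i - 1 / 2 - (r j - 1 / 2) := by linarith
    refine ⟨![-(r j - 1 / 2) / (r i - 1 / 2 - (r j - 1 / 2)),
      (r i - 1 / 2) / (r i - 1 / 2 - (r j - 1 / 2))], ![r i, r j], ⟨?_, ?_⟩, ?_, ?_, ?_⟩
    · rw [Fin.forall_fin_two]
      exact ⟨div_nonneg (by linarith) hpos.le, div_nonneg hi hpos.le⟩
    · rw [Fin.sum_univ_two]
      simp only [Matrix.cons_val]
      rw [← add_div]
      exact div_eq_one_iff_eq hpos.ne' |>.2 (by ring)
    · rw [Fin.forall_fin_two]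
      exact ⟨hr i, hr j⟩
    · rw [Fin.sum_univ_two]
      simp only [Matrix.cons_val]
      have : r i - r j ≠ 0 := by linarith
      rw [show r i - 1 / 2 - (r j - 1 / 2) = r i - r j by ring]
      field_simp
      ring
    · rw [Fin.sum_univ_two]
      rfl

/-! ### From arbitrary measures to finite mixtures -/

/-- Every achievable pair of finite divergences is a finite mixture. -/
theorem Achievable.exists_isMixture {f g : ℝ → ℝ} (hf : ConvexOn ℝ (Set.Ioi 0) f)
    (hg : ConvexOn ℝ (Set.Ioi 0) g) {z : ℝ × ℝ} (h : Achievable.{u} f g z) :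
    ∃ (ι : Type) (_ : Fintype ι), IsMixture ι f g z := by
  obtain ⟨Ω, _, P, Q, hP, hQ, h1, h2⟩ := h
  obtain ⟨fin1, int1, eq1⟩ := (fDiv_eq_coe_iff hf P Q).1 h1
  obtain ⟨fin2, int2, eq2⟩ := (fDiv_eq_coe_iff hg P Q).1 h2
  have hPQ : P ≪ P + Q := Measure.AbsolutelyContinuous.rfl.add_right Q
  set r : Ω → ℝ := fun x => (P.rnDeriv (P + Q) x).toReal with hr
  have hr01 : ∀ᵐ x ∂(P + Q), r x ∈ Set.Icc (0 : ℝ) 1 := by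
    filter_upwards [Measure.rnDeriv_add P Q (P + Q), Measure.rnDeriv_self (P + Q)] with x h1 h2
    refine ⟨ENNReal.toReal_nonneg, ENNReal.toReal_le_of_le_ofReal zero_le_one ?_⟩
    rw [ENNReal.ofReal_one, ← h2, h1]
    exact le_self_add
  have hrint : Integrable r (P + Q) := Measure.integrable_toReal_rnDeriv
  have hrmean : ∫ x, r x ∂(P + Q) = 1 := by
    rw [hr, Measure.integral_toReal_rnDeriv hPQ, probReal_univ]
  let ν : Measure Ω := (2⁻¹ : ENNReal) • (P + Q)
  have hν : IsProbabilityMeasure ν := ⟨by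
    simp only [ν, Measure.smul_apply, Measure.add_apply, measure_univ, smul_eq_mul]
    rw [one_add_one_eq_two, ENNReal.inv_mul_cancel two_ne_zero ENNReal.ofNat_ne_top]⟩
  have hac : ν ≪ P + Q := Measure.smul_absolutelyContinuous
  -- Keeping `r` as an extra coordinate preserves the constraint of mean 1/2 in the finite
  -- combination.
  let X : Ω → ℝ × (ℝ × ℝ) := fun x => (r x, curve f g (r x))
  have hcint : Integrable (fun x => curve f g (r x)) (P + Q) :=
    (int1.const_mul 2).prodMk (int2.const_mul 2)
  have hXint : Integrable X (P + Q) := hrint.prodMk hcint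
  -- `finiteDomain f g` may omit 0 or 1, so this hull need not be closed; the lemma on means does
  -- not ask for it.
  have hXae : ∀ᵐ x ∂ν, X x ∈ convexHull ℝ ((fun s => (s, curve f g s)) '' finiteDomain f g) := by
    refine hac.ae_le ?_
    filter_upwards [hr01, fin1, fin2] with x hx1 hx2 hx3
    exact subset_convexHull ℝ _ ⟨r x, ⟨hx1, hx2, hx3⟩, rfl⟩
  have hmem := (convex_convexHull ℝ _).integral_mem_of_finiteDimensional hXae
    (hXint.smul_measure (by simp))
  have hmean : ∫ x, X x ∂ν = (1 / 2, z) := by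
    have hpair : ∫ x, X x ∂(P + Q) = (1, 2 • z) := by
      rw [integral_pair hrint hcint, hrmean,
        show (fun x => curve f g (r x)) = fun x => (2 * (perspective f (r x)).toReal,
          2 * (perspective g (r x)).toReal) from rfl,
        integral_pair (int1.const_mul 2) (int2.const_mul 2), integral_const_mul,
        integral_const_mul, eq1, eq2]
      ext <;> simp
    rw [integral_smul_measure, hpair]
    ext <;> simp
  rw [hmean, mem_convexHull_iff_exists_fintype] at hmem
  obtain ⟨ι, hι, w, y, hw, hw1, hy, hsum⟩ := hmem
  choose s hs hsy using hy
  have hsy' : y = fun i => (s i, curve f g (s i)) := funext fun i => (hsy i).symm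
  subst hsy'
  refine ⟨ι, hι, w, s, ⟨hw, hw1⟩, hs, ?_, ?_⟩
  · simpa [Prod.fst_sum] using congrArg Prod.fst hsum
  · simpa [Prod.snd_sum] using congrArg Prod.snd hsum

end JointRange

/-! ### The joint range theorem -/

theorem mainTheorem1 (f g : ℝ → ℝ)
    (hf : ConvexOn ℝ (Set.Ioi 0) f) (hf1 : f 1 = 0)
    (hg : ConvexOn ℝ (Set.Ioi 0) g) (hg1 : g 1 = 0) :
    (∀ z : ℝ × ℝ, JointRange.Achievable.{u} f g z →
      ∃ a b : ℝ × ℝ, JointRange.DAchievable f g 2 a ∧ JointRange.DAchievable f g 2 b ∧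
        z ∈ segment ℝ a b) ∧
    (∀ z : ℝ × ℝ, JointRange.Achievable.{u} f g z → JointRange.DAchievable f g 4 z) ∧
    {z : ℝ × ℝ | JointRange.Achievable.{u} f g z} =
      convexHull ℝ {z : ℝ × ℝ | JointRange.DAchievable f g 2 z} := by
  simp only [JointRange.dAchievable_iff_isMixture hf hg]
  have hull : ∀ z, JointRange.Achievable.{u} f g z →
      z ∈ convexHull ℝ {z | JointRange.IsMixture (Fin 2) f g z} := fun z hz => by
    obtain ⟨ι, _, h⟩ := hz.exists_isMixture hf hg
    exact h.mem_convexHull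
  have seg : ∀ z ∈ convexHull ℝ {z | JointRange.IsMixture (Fin 2) f g z},
      ∃ a b : ℝ × ℝ, JointRange.IsMixture (Fin 2) f g a ∧ JointRange.IsMixture (Fin 2) f g b ∧
        z ∈ segment ℝ a b := fun z hz => by
    obtain ⟨a, ha, b, hb, h⟩ :=
      (JointRange.isPreconnected_isMixture (Fin 2) hf hg).exists_mem_segment_of_mem_convexHull hz
    exact ⟨a, b, ha, hb, h⟩
  -- Two 2-point mixtures, reweighted, form one on four points; this also shows that every point of
  -- the hull is achievable.
  have four : ∀ z ∈ convexHull ℝ {z | JointRange.IsMixture (Fin 2) f g z},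
      JointRange.IsMixture (Fin 4) f g z := fun z hz => by
    obtain ⟨a, b, ha, hb, h⟩ := seg z hz
    exact (ha.segment hb h).equiv (finSumFinEquiv (m := 2) (n := 2)).symm
  exact ⟨fun z hz => seg z (hull z hz), fun z hz => four z (hull z hz),
    Set.Subset.antisymm hull fun z hz => (four z hz).achievable hf hg⟩
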